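/- Let $\nu\ge 2$ and $x_0\ge 0$ be integers, and let $x_{n+1}=\pm\sqrt{\nu+x_n}\in\mathbb{C}$ for $n\ge 0$, with any choice of the sign at each step. Put $K_n=\mathbb{Q}(x_n)$ and $K^{\nu,x_0}=\bigcup_{n\ge 0}K_n$. Assume that $[K_{n+1}:K_n]=2$ for every $n\ge 0$ and that $K^{\nu,x_0}$ is totally real. Let $m\ge 1$ be an integer and $\zeta_m$ a primitive $m$-th root of unity in $\mathbb{C}$. If $\zeta_m+\zeta_m^{-1}\in K^{\nu,x_0}$, then $m$ has one of the following forms: 1. $m=2^r p_1p_2$ with $0\le r\le 2$ and $p_1,p_2$ distinct Fermat primes; 2. $m=2^r p_1$ with $r\ge 0$ and $p_1$ a Fermat prime; 3. $m=2^r$ with $r\ge 0$. (A Fermat prime is a prime number of the form $2^{2^k}+1$ with $k\ge 0$.) -/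

import Mathlib

open IntermediateField

noncomputable section

namespace SqrtTower

/-- The sequence `x 0 = x₀`, `x (n + 1) = ± √(ν + x n)` of complex numbers; the sign chosen at
step `n` is `s n`. -/
def seq (s : ℕ → ℤˣ) (ν x₀ : ℤ) : ℕ → ℂ
  | 0 => (x₀ : ℂ)
  | n + 1 => ((s n : ℤ) : ℂ) * Complex.sqrt ((ν : ℂ) + seq s ν x₀ n)

/-- The `n`-th field of the tower, `K_n = ℚ(x_n)`. -/
def level (s : ℕ → ℤˣ) (ν x₀ : ℤ) (n : ℕ) : IntermediateField ℚ ℂ :=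
  ℚ⟮seq s ν x₀ n⟯

/-- The field `K = ⋃ K_n`. The supremum is the union of the sets `K_n`, see `coe_field`. -/
def field (s : ℕ → ℤˣ) (ν x₀ : ℤ) : IntermediateField ℚ ℂ :=
  ⨆ n, level s ν x₀ n

theorem seq_succ_sq (s : ℕ → ℤˣ) (ν x₀ : ℤ) (n : ℕ) :
    seq s ν x₀ (n + 1) ^ 2 = (ν : ℂ) + seq s ν x₀ n := by
  have h1 : Complex.sqrt ((ν : ℂ) + seq s ν x₀ n) ^ 2 = (ν : ℂ) + seq s ν x₀ n := by
    unfold Complex.sqrt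
    exact Complex.cpow_nat_inv_pow _ two_ne_zero
  have h2 : (((s n : ℤˣ) : ℤ) : ℂ) ^ 2 = 1 := by
    rcases Int.units_eq_one_or (s n) with h | h <;> simp [h]
  rw [seq, mul_pow, h1, h2, one_mul]

theorem level_le_succ (s : ℕ → ℤˣ) (ν x₀ : ℤ) (n : ℕ) :
    level s ν x₀ n ≤ level s ν x₀ (n + 1) := by
  unfold level
  rw [adjoin_simple_le_iff]
  have h : seq s ν x₀ n = seq s ν x₀ (n + 1) ^ 2 - (ν : ℂ) := by
    rw [seq_succ_sq]; ring
  rw [h]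
  exact sub_mem (pow_mem (mem_adjoin_simple_self ℚ _) 2) (intCast_mem _ ν)

theorem coe_field (s : ℕ → ℤˣ) (ν x₀ : ℤ) :
    (field s ν x₀ : Set ℂ) = ⋃ n, (level s ν x₀ n : Set ℂ) :=
  coe_iSup_of_directed (monotone_nat_of_le_succ (level_le_succ s ν x₀)).directed_le

/-- The set `Ω` of the pairs `(ν, x₀)` of integers, `ν ≥ 2` and `x₀ ≥ 0`, such that
`[K_{n+1} : K_n] = 2` for every `n` and `K` is totally real. (As `K_n ≤ K_{n+1}`, see
`level_le_succ`, the relative rank is the degree.) -/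
def Omega (s : ℕ → ℤˣ) : Set (ℤ × ℤ) :=
  {p | 2 ≤ p.1 ∧ 0 ≤ p.2 ∧
    (∀ n, (level s p.1 p.2 n).relfinrank (level s p.1 p.2 (n + 1)) = 2) ∧
    NumberField.IsTotallyReal (field s p.1 p.2)}

/-- A Fermat prime: a prime number of the form `2 ^ (2 ^ k) + 1`. -/
def IsFermatPrime (p : ℕ) : Prop :=
  p.Prime ∧ ∃ k, p = Nat.fermatNumber k

end SqrtTower

end

/-! The tower contains at most one quadratic extension of `K_1`. If `r` lies in `K_{n+2}` but not in
`K_{n+1}` and `r ^ 2 ∈ K_n`, then `r = v * x_{n+2}` and the norm of `r ^ 2` down to `K_n` shows that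
`ν ^ 2 - ν - x_n` is a square in `K_n`. Repeated norms turn this into a condition on integers, which
the bound `x₀ ≤ ν ^ 2 - ν` coming from total reality excludes for `n ≥ 1`; the pair `(2, 1)` needs a
separate argument. Hence square roots of elements of `K_1` inside the tower lie in `K_2`
(`mem_level_two_of_sq_mem`).

Let `L` be a finite abelian extension of `ℚ` inside the tower. Over `L ∩ K_1` its group is an
abelian `2`-group with at most one maximal subgroup, hence cyclic, so `Gal(L/ℚ)` has a cyclic
subgroup of index at most `2`. For `L = ℚ(ζ + ζ⁻¹)` this makes `φ(m)` a power of `2` and gives a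
unit modulo `m` of order at least `φ(m) / 4`. That order is attained modulo one prime power `p ^ v`
exactly dividing `m`, so `φ(m / p ^ v) ≤ 4`, which leaves the three forms. -/

namespace SqrtTower

/-- Coordinates with respect to `1, x` are unique when `x` lies outside the base field. -/
theorem eq_zero_of_add_mul_eq_zero {F : IntermediateField ℚ ℂ} {x u v : ℂ} (hx : x ∉ F)
    (hu : u ∈ F) (hv : v ∈ F) (h : u + v * x = 0) : u = 0 ∧ v = 0 := by
  have hv0 : v = 0 := by
    by_contra hv0
    refine hx ?_
    have : x = -u / v := by
      rw [eq_div_iff hv0]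
      linear_combination h
    rw [this]
    exact div_mem (neg_mem hu) hv
  subst hv0
  simpa using h

/-! ### Structure of the levels -/

variable {s : ℕ → ℤˣ} {ν x₀ : ℤ}

theorem isIntegral_seq (n : ℕ) : IsIntegral ℚ (seq s ν x₀ n) := by
  induction n with
  | zero =>
    have h := isIntegral_algebraMap (R := ℚ) (A := ℂ) (x := (x₀ : ℚ))
    simpa [seq] using h
  | succ n ih =>
    have h := isIntegral_algebraMap (R := ℚ) (A := ℂ) (x := (ν : ℚ))
    refine IsIntegral.of_pow (n := 2) two_pos ?_
    rw [seq_succ_sq]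
    refine IsIntegral.add ?_ ih
    simpa using h

theorem seq_mem_level (n : ℕ) : seq s ν x₀ n ∈ level s ν x₀ n :=
  mem_adjoin_simple_self ℚ _

theorem level_mono : Monotone (level s ν x₀) :=
  monotone_nat_of_le_succ (level_le_succ s ν x₀)

theorem level_le_field (n : ℕ) : level s ν x₀ n ≤ field s ν x₀ :=
  le_iSup (level s ν x₀) n

theorem mem_field_iff {z : ℂ} : z ∈ field s ν x₀ ↔ ∃ n, z ∈ level s ν x₀ n := by
  rw [← SetLike.mem_coe, coe_field]
  simp

theorem level_zero : level s ν x₀ 0 = ⊥ := by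
  unfold level
  rw [adjoin_simple_eq_bot_iff]
  exact intCast_mem _ x₀

theorem exists_eq_add_mul_of_mem_level_succ {n : ℕ} {z : ℂ} (hz : z ∈ level s ν x₀ (n + 1)) :
    ∃ u ∈ level s ν x₀ n, ∃ v ∈ level s ν x₀ n, z = u + v * seq s ν x₀ (n + 1) := by
  have hz' : z ∈ Algebra.adjoin ℚ {seq s ν x₀ (n + 1)} := by
    rw [← adjoin_simple_toSubalgebra_of_isAlgebraic (isIntegral_seq (n + 1)).isAlgebraic]
    exact hz
  have hsq := seq_succ_sq s ν x₀ n
  induction hz' using Algebra.adjoin_induction with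
  | mem x hx =>
    rw [Set.mem_singleton_iff] at hx
    exact ⟨0, zero_mem _, 1, one_mem _, by simp [hx]⟩
  | algebraMap r => exact ⟨algebraMap ℚ ℂ r, _root_.algebraMap_mem _ r, 0, zero_mem _, by simp⟩
  | add x y hx hy ihx ihy =>
    rw [← adjoin_simple_toSubalgebra_of_isAlgebraic (isIntegral_seq (n + 1)).isAlgebraic]
      at hx hy
    obtain ⟨u, hu, v, hv, rfl⟩ := ihx hx
    obtain ⟨u', hu', v', hv', rfl⟩ := ihy hy
    exact ⟨u + u', add_mem hu hu', v + v', add_mem hv hv', by ring⟩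
  | mul x y hx hy ihx ihy =>
    rw [← adjoin_simple_toSubalgebra_of_isAlgebraic (isIntegral_seq (n + 1)).isAlgebraic]
      at hx hy
    obtain ⟨u, hu, v, hv, rfl⟩ := ihx hx
    obtain ⟨u', hu', v', hv', rfl⟩ := ihy hy
    refine ⟨u * u' + v * v' * (ν + seq s ν x₀ n), ?_, u * v' + v * u', ?_, ?_⟩
    · exact add_mem (mul_mem hu hu') (mul_mem (mul_mem hv hv')
        (add_mem (intCast_mem _ ν) (seq_mem_level n)))
    · exact add_mem (mul_mem hu hv') (mul_mem hv hu')
    · linear_combination v * v' * hsq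

theorem seq_succ_not_mem_level
    (hdeg : ∀ n, (level s ν x₀ n).relfinrank (level s ν x₀ (n + 1)) = 2)
    (n : ℕ) : seq s ν x₀ (n + 1) ∉ level s ν x₀ n := by
  intro h
  have h1 : level s ν x₀ (n + 1) ≤ level s ν x₀ n := by
    unfold level at h ⊢
    rwa [adjoin_simple_le_iff]
  have h2 := hdeg n
  rw [relfinrank_eq_one_iff.mpr h1] at h2
  omega

theorem finrank_level
    (hdeg : ∀ n, (level s ν x₀ n).relfinrank (level s ν x₀ (n + 1)) = 2)
    (n : ℕ) : Module.finrank ℚ (level s ν x₀ n) = 2 ^ n := by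
  rw [← relfinrank_bot_left]
  induction n with
  | zero => rw [level_zero, relfinrank_self, pow_zero]
  | succ n ih =>
    rw [← relfinrank_mul_relfinrank bot_le (level_le_succ s ν x₀ n), ih, hdeg, pow_succ]

/-! ### Norms and squares in the tower -/

/-- Taking the norm down one level. -/
theorem exists_sq_eq_sub_seq
    (hdeg : ∀ n, (level s ν x₀ n).relfinrank (level s ν x₀ (n + 1)) = 2)
    {n : ℕ} {c : ℤ}
    (h : ∃ w ∈ level s ν x₀ (n + 1), w ^ 2 = c - seq s ν x₀ (n + 1)) :
    ∃ w ∈ level s ν x₀ n, w ^ 2 = ((c ^ 2 - ν : ℤ) : ℂ) - seq s ν x₀ n := by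
  obtain ⟨w, hw, hw2⟩ := h
  obtain ⟨u, hu, v, hv, rfl⟩ := exists_eq_add_mul_of_mem_level_succ hw
  have hsq := seq_succ_sq s ν x₀ n
  have hν : (ν : ℂ) + seq s ν x₀ n ∈ level s ν x₀ n :=
    add_mem (intCast_mem _ ν) (seq_mem_level n)
  obtain ⟨h1, h2⟩ := eq_zero_of_add_mul_eq_zero
    (u := u ^ 2 + v ^ 2 * (ν + seq s ν x₀ n) - c) (v := 2 * u * v + 1)
    (seq_succ_not_mem_level hdeg n)
    (sub_mem (add_mem (pow_mem hu 2) (mul_mem (pow_mem hv 2) hν)) (intCast_mem _ c))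
    (add_mem (mul_mem (mul_mem (ofNat_mem _ 2) hu) hv) (one_mem _))
    (by linear_combination hw2 - v ^ 2 * hsq)
  -- The witness is the norm of `w`; the norm of `c - x_{n+1}` is `c ^ 2 - ν - x_n`.
  refine ⟨u ^ 2 - v ^ 2 * (ν + seq s ν x₀ n), sub_mem (pow_mem hu 2) (mul_mem (pow_mem hv 2) hν),
    ?_⟩
  push_cast
  linear_combination (u ^ 2 + v ^ 2 * (ν + seq s ν x₀ n) + c) * h1
    - (2 * u * v - 1) * (ν + seq s ν x₀ n) * h2

/-- A quadratic irrationality that appears at level `n + 2` with its square at level `n` forces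
`ν ^ 2 - ν - x n` to be a square at level `n`. -/
theorem exists_sq_eq_of_mem_level
    (hdeg : ∀ n, (level s ν x₀ n).relfinrank (level s ν x₀ (n + 1)) = 2)
    {n : ℕ} {r : ℂ} (hr : r ∈ level s ν x₀ (n + 2))
    (hr' : r ∉ level s ν x₀ (n + 1)) (hr2 : r ^ 2 ∈ level s ν x₀ n) :
    ∃ w ∈ level s ν x₀ n, w ^ 2 = ((ν ^ 2 - ν : ℤ) : ℂ) - seq s ν x₀ n := by
  obtain ⟨u, hu, v, hv, rfl⟩ := exists_eq_add_mul_of_mem_level_succ hr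
  have hsq := seq_succ_sq s ν x₀ n
  have hsq' := seq_succ_sq s ν x₀ (n + 1)
  set X := seq s ν x₀ (n + 1) with hX
  set Y := seq s ν x₀ (n + 1 + 1) with hY
  set δ := (u + v * Y) ^ 2 with hδ
  have hν : (ν : ℂ) + seq s ν x₀ n ∈ level s ν x₀ n :=
    add_mem (intCast_mem _ ν) (seq_mem_level n)
  have hν' : (ν : ℂ) + X ∈ level s ν x₀ (n + 1) :=
    add_mem (intCast_mem _ ν) (seq_mem_level (n + 1))
  have hv0 : v ≠ 0 := by
    rintro rfl
    exact hr' (by simpa using hu)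
  obtain ⟨h1, h2⟩ := eq_zero_of_add_mul_eq_zero
    (u := u ^ 2 + v ^ 2 * (ν + X) - δ) (v := 2 * u * v)
    (seq_succ_not_mem_level hdeg (n + 1))
    (sub_mem (add_mem (pow_mem hu 2) (mul_mem (pow_mem hv 2) hν')) (level_le_succ _ _ _ _ hr2))
    (mul_mem (mul_mem (ofNat_mem _ 2) hu) hv)
    (by linear_combination hδ - v ^ 2 * hsq')
  have hu0 : u = 0 := by simpa [hv0] using h2
  subst hu0
  obtain ⟨p, hp, q, hq, rfl⟩ := exists_eq_add_mul_of_mem_level_succ hv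
  have hXn := seq_succ_not_mem_level hdeg n
  set b := (ν : ℂ) + seq s ν x₀ n with hb
  obtain ⟨h3, h4⟩ := eq_zero_of_add_mul_eq_zero
    (u := ν * (p ^ 2 + q ^ 2 * b) + 2 * p * q * b - δ)
    (v := p ^ 2 + q ^ 2 * b + 2 * p * q * ν) hXn
    (sub_mem (add_mem (mul_mem (intCast_mem _ ν) (add_mem (pow_mem hp 2)
      (mul_mem (pow_mem hq 2) hν))) (mul_mem (mul_mem (mul_mem (ofNat_mem _ 2) hp) hq) hν)) hr2)
    (add_mem (add_mem (pow_mem hp 2) (mul_mem (pow_mem hq 2) hν))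
      (mul_mem (mul_mem (mul_mem (ofNat_mem _ 2) hp) hq) (intCast_mem _ ν)))
    (by linear_combination h1 - (q ^ 2 * ν + 2 * p * q + q ^ 2 * X) * hsq)
  have hN : p ^ 2 - q ^ 2 * b ≠ 0 := by
    intro h0
    have h5 : (p + q * X) * (p + -q * X) = 0 := by linear_combination h0 - q ^ 2 * hsq
    rcases mul_eq_zero.mp h5 with h | h
    · exact hv0 h
    · obtain ⟨h6, h7⟩ := eq_zero_of_add_mul_eq_zero hXn hp (neg_mem hq) h
      rw [neg_eq_zero] at h7
      exact hv0 (by simp [h6, h7])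
  -- With `δ = v ^ 2 * (ν + X)`, norms give `δ ^ 2 = N(v) ^ 2 * (ν ^ 2 - X ^ 2)`, where `N(v) = p ^
  -- 2 - q ^ 2 * b`.
  refine ⟨δ / (p ^ 2 - q ^ 2 * b), div_mem hr2 (sub_mem (pow_mem hp 2)
    (mul_mem (pow_mem hq 2) hν)), ?_⟩
  rw [div_pow, div_eq_iff (pow_ne_zero 2 hN)]
  push_cast
  clear_value δ b
  have e : seq s ν x₀ n = b - ν := by rw [hb]; ring
  rw [e]
  linear_combination (-(ν * (p ^ 2 + q ^ 2 * b) + 2 * p * q * b + δ)) * h3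
    + (p ^ 2 + q ^ 2 * b + 2 * p * q * ν) * b * h4

theorem seq_one_sq : seq s ν x₀ 1 ^ 2 = ν + x₀ :=
  seq_succ_sq s ν x₀ 0

/-! ### Total reality and the bound on the starting value -/

/-- The conjugate of `x 1` is `-x 1`, realised by an embedding of the whole tower. -/
theorem exists_algHom_seq_one_eq_neg
    (hdeg : ∀ n, (level s ν x₀ n).relfinrank (level s ν x₀ (n + 1)) = 2) :
    ∃ φ : field s ν x₀ →ₐ[ℚ] ℂ,
      φ ⟨seq s ν x₀ 1, level_le_field 1 (seq_mem_level 1)⟩ = -seq s ν x₀ 1 := by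
  have halg : Algebra.IsAlgebraic ℚ (field s ν x₀) := by
    refine ⟨fun z => ?_⟩
    obtain ⟨n, hn⟩ := mem_field_iff.mp z.2
    have : FiniteDimensional ℚ (level s ν x₀ n) :=
      adjoin.finiteDimensional (isIntegral_seq n)
    have h1 := (Algebra.IsAlgebraic.isAlgebraic (R := ℚ) (⟨z, hn⟩ : level s ν x₀ n)).algebraMap
      (A := ℂ)
    exact (isAlgebraic_algebraMap_iff (algebraMap (field s ν x₀) ℂ).injective).mp h1
  set y : field s ν x₀ := ⟨seq s ν x₀ 1, level_le_field 1 (seq_mem_level 1)⟩ with hy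
  have hmin : minpoly ℚ y = minpoly ℚ (seq s ν x₀ 1) := by
    rw [hy]
    exact (minpoly.algebraMap_eq (B := field s ν x₀) (B' := ℂ)
      (algebraMap (field s ν x₀) ℂ).injective y).symm
  have hroot : Polynomial.aeval (-seq s ν x₀ 1) (minpoly ℚ (seq s ν x₀ 1)) = 0 := by
    have hp : minpoly ℚ (seq s ν x₀ 1) = Polynomial.X ^ 2 - Polynomial.C ((ν + x₀ : ℤ) : ℚ) := by
      refine (minpoly.eq_of_irreducible_of_monic ?_ ?_ ?_).symm
      · refine X_pow_sub_C_irreducible_of_prime Nat.prime_two ?_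
        intro b hb
        apply seq_succ_not_mem_level hdeg 0
        have h1 : seq s ν x₀ (0 + 1) ^ 2 = (b : ℂ) ^ 2 := by
          rw [zero_add, seq_one_sq]
          have := congrArg (fun t : ℚ => (t : ℂ)) hb
          push_cast at this
          exact this.symm
        rcases sq_eq_sq_iff_eq_or_eq_neg.mp h1 with h | h
        · rw [h]
          exact SubfieldClass.ratCast_mem _ b
        · rw [h]
          exact neg_mem (SubfieldClass.ratCast_mem _ b)
      · simp [seq_one_sq]
      · exact Polynomial.monic_X_pow_sub_C _ two_ne_zero
    simp [hp, seq_one_sq]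
  have hmem : -seq s ν x₀ 1 ∈ Set.range fun φ : field s ν x₀ →ₐ[ℚ] ℂ => φ y := by
    rw [Algebra.IsAlgebraic.range_eval_eq_rootSet_minpoly, hmin,
      Polynomial.mem_rootSet]
    exact ⟨minpoly.ne_zero (isIntegral_seq 1), hroot⟩
  exact hmem

/-- Total reality of the tower bounds the starting value. -/
theorem start_le (hν : 2 ≤ ν) (hx₀ : 0 ≤ x₀)
    (hdeg : ∀ n, (level s ν x₀ n).relfinrank (level s ν x₀ (n + 1)) = 2)
    (hreal : NumberField.IsTotallyReal (field s ν x₀)) : x₀ ≤ ν ^ 2 - ν := by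
  by_contra! hlt
  have key : ∀ φ : field s ν x₀ →ₐ[ℚ] ℂ,
      ∃ t : ℝ, (t : ℂ) ^ 2 = ν + φ ⟨seq s ν x₀ 1, level_le_field 1 (seq_mem_level 1)⟩ := by
    intro φ
    have h1 := hreal.isReal (NumberField.InfinitePlace.mk (φ : field s ν x₀ →+* ℂ))
    rw [NumberField.InfinitePlace.isReal_mk_iff] at h1
    set z : field s ν x₀ := ⟨seq s ν x₀ 2, level_le_field 2 (seq_mem_level 2)⟩ with hz
    have hzz : z ^ 2 = (ν : field s ν x₀) + ⟨seq s ν x₀ 1, level_le_field 1 (seq_mem_level 1)⟩ := by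
      apply Subtype.ext
      push_cast
      exact seq_succ_sq s ν x₀ 1
    have h2 := NumberField.ComplexEmbedding.IsReal.coe_embedding_apply h1 z
    refine ⟨h1.embedding z, ?_⟩
    rw [h2]
    have := congrArg φ hzz
    simpa using this
  have hsq : seq s ν x₀ 1 ^ 2 = (((ν + x₀ : ℤ) : ℝ) : ℂ) := by
    rw [seq_one_sq]; push_cast; rfl
  have hpos : (0 : ℝ) ≤ ((ν + x₀ : ℤ) : ℝ) := by exact_mod_cast by omega
  set a : ℝ := √((ν + x₀ : ℤ) : ℝ) with ha
  have ha2 : a ^ 2 = ((ν + x₀ : ℤ) : ℝ) := Real.sq_sqrt hpos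
  have hνa : (ν : ℝ) < a := by
    refine Real.lt_sqrt_of_sq_lt ?_
    exact_mod_cast by linarith
  have hval : seq s ν x₀ 1 = (a : ℂ) ∨ seq s ν x₀ 1 = -(a : ℂ) := by
    rw [← sq_eq_sq_iff_eq_or_eq_neg, hsq, ← ha2]
    push_cast
    rfl
  -- `ν - a` is negative, yet under a suitable embedding it is the square of the image of `x_2`,
  -- which is real.
  have hfin : ∀ t : ℝ, (t : ℂ) ^ 2 ≠ ν + -(a : ℂ) := by
    intro t ht
    have : t ^ 2 = ν + -a := by exact_mod_cast ht
    nlinarith [sq_nonneg t]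
  rcases hval with h | h
  · obtain ⟨φ, hφ⟩ := exists_algHom_seq_one_eq_neg hdeg
    obtain ⟨t, ht⟩ := key φ
    rw [hφ, h] at ht
    exact hfin t ht
  · obtain ⟨t, ht⟩ := key (field s ν x₀).val
    refine hfin t ?_
    rw [ht, ← h]
    rfl

/-! ### Excluding the squares -/

/-- Elements of `ℚ` whose square is an integer. -/
theorem exists_int_sq_eq {c : ℤ} (h : ∃ w ∈ level s ν x₀ 0, w ^ 2 = (c : ℂ)) :
    ∃ k : ℤ, 0 ≤ k ∧ k ^ 2 = c := by
  obtain ⟨w, hw, hw2⟩ := h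
  rw [level_zero, mem_bot] at hw
  obtain ⟨q, rfl⟩ := hw
  have hq : q ^ 2 = (c : ℚ) := by
    rw [eq_ratCast] at hw2
    exact_mod_cast hw2
  have hs : IsSquare c := by
    rw [← Rat.isSquare_intCast_iff]
    exact ⟨q, by rw [← hq, sq]⟩
  obtain ⟨k, rfl⟩ := hs
  exact ⟨|k|, abs_nonneg k, by rw [sq_abs, sq]⟩

/-- The norm replaces `c` by `c ^ 2 - ν`, which is again at least `ν ^ 2 - ν`. At the bottom `c ^ 2
- (ν + x₀)` would be a perfect square, but `c` is too large for the gap between consecutive squares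
unless `ν = 2`. -/
theorem no_sq_eq_sub_seq (hν : 2 ≤ ν) (hx₀ : 0 ≤ x₀)
    (hdeg : ∀ n, (level s ν x₀ n).relfinrank (level s ν x₀ (n + 1)) = 2)
    (hle : x₀ ≤ ν ^ 2 - ν) (hne : ¬ (ν = 2 ∧ x₀ = 1)) (n : ℕ) {c : ℤ} (hc : ν ^ 2 - ν ≤ c) :
    ¬ ∃ w ∈ level s ν x₀ (n + 1), w ^ 2 = (c : ℂ) - seq s ν x₀ (n + 1) := by
  induction n generalizing c with
  | zero =>
    intro h
    obtain ⟨k, hk, hk2⟩ := exists_int_sq_eq (c := c ^ 2 - ν - x₀) <| by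
      obtain ⟨w, hw, h2⟩ := exists_sq_eq_sub_seq hdeg h
      refine ⟨w, hw, h2.trans ?_⟩
      simp [seq]
    -- From `k < c` follows `2 * c - 1 ≤ ν + x₀ ≤ ν ^ 2`, whence `ν = 2`.
    have hc0 : 0 < c := by nlinarith
    have hkc : k ≤ c - 1 := by
      by_contra! hlt
      nlinarith
    have h3 : k ^ 2 ≤ (c - 1) ^ 2 := by nlinarith
    have hν2 : ν = 2 := by nlinarith
    subst hν2
    have hx2 : x₀ = 2 := by
      have : x₀ ≠ 1 := fun h => hne ⟨rfl, h⟩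
      have h5 : 2 ≤ c := by linarith
      have h6 : x₀ ≤ 2 := by linarith
      have h7 : 1 ≤ x₀ := by nlinarith
      omega
    subst hx2
    -- Here `x_1 = ±2` is rational, against the degree hypothesis.
    apply seq_succ_not_mem_level hdeg 0
    have h4 : seq s 2 2 (0 + 1) ^ 2 = (2 : ℂ) ^ 2 := by
      rw [zero_add, seq_one_sq]
      norm_num
    rcases sq_eq_sq_iff_eq_or_eq_neg.mp h4 with h | h
    · rw [h]
      exact ofNat_mem _ 2
    · rw [h]
      exact neg_mem (ofNat_mem _ 2)
  | succ n ih =>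
    intro h
    refine ih (c := c ^ 2 - ν) ?_ (exists_sq_eq_sub_seq hdeg h)
    have h1 : ν ≤ c := by nlinarith
    nlinarith

/-- The value `c = 2` is fixed by `c ↦ c ^ 2 - 2`, and the last norm, `2 ^ 2 - 2 - 1 = 1`, is a
square. So the descent stops at `K_1 = ℚ(√3)`, where `2 ∓ √3` is shown directly not to be a square.
-/
theorem no_sq_eq_two_sub_seq
    (hdeg : ∀ n, (level s 2 1 n).relfinrank (level s 2 1 (n + 1)) = 2) (n : ℕ) :
    ¬ ∃ w ∈ level s 2 1 (n + 1), w ^ 2 = ((2 : ℤ) : ℂ) - seq s 2 1 (n + 1) := by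
  induction n with
  | zero =>
    rintro ⟨w, hw, hw2⟩
    obtain ⟨u, hu, v, hv, rfl⟩ := exists_eq_add_mul_of_mem_level_succ hw
    have hsq := seq_succ_sq s 2 1 0
    have h0 : seq s 2 1 0 = 1 := by simp [seq]
    rw [h0] at hsq
    push_cast at hsq hw2
    obtain ⟨h1, h2⟩ := eq_zero_of_add_mul_eq_zero
      (u := u ^ 2 + 3 * v ^ 2 - 2) (v := 2 * u * v + 1)
      (seq_succ_not_mem_level hdeg 0)
      (sub_mem (add_mem (pow_mem hu 2) (mul_mem (ofNat_mem _ 3) (pow_mem hv 2))) (ofNat_mem _ 2))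
      (add_mem (mul_mem (mul_mem (ofNat_mem _ 2) hu) hv) (one_mem _))
      (by linear_combination hw2 - v ^ 2 * hsq)
    -- Eliminating `v` leaves a quadratic in `(2 * u) ^ 2` with roots `2` and `6`, neither a
    -- rational square.
    have h3 : ((2 * u) ^ 2 - 2) * ((2 * u) ^ 2 - 6) = 0 := by
      linear_combination (16 * u ^ 2) * h1 - (12 * (2 * u * v - 1)) * h2
    have hm : 2 * u ∈ level s 2 1 0 := mul_mem (ofNat_mem _ 2) hu
    rcases mul_eq_zero.mp h3 with h | h
    · obtain ⟨k, hk, hk2⟩ := exists_int_sq_eq (c := 2) ⟨2 * u, hm, by push_cast; linear_combination h⟩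
      have : k ≤ 1 := by nlinarith
      interval_cases k <;> omega
    · obtain ⟨k, hk, hk2⟩ := exists_int_sq_eq (c := 6) ⟨2 * u, hm, by push_cast; linear_combination h⟩
      have : k ≤ 2 := by nlinarith
      interval_cases k <;> omega
  | succ n ih =>
    intro h
    exact ih (by simpa using exists_sq_eq_sub_seq hdeg h)

/-! ### Uniqueness of the quadratic extension of `K_1` -/

/-- Every square root of an element of `K_1` that lies in the tower already lies in `K_2`. -/
theorem mem_level_two_of_sq_mem (h : (ν, x₀) ∈ Omega s) {r : ℂ} (hr : r ∈ field s ν x₀)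
    (hr2 : r ^ 2 ∈ level s ν x₀ 1) : r ∈ level s ν x₀ 2 := by
  obtain ⟨hν, hx₀, hdeg, hreal⟩ := h
  dsimp only at hν hx₀ hdeg hreal
  obtain ⟨n, hn⟩ := mem_field_iff.mp hr
  have hn' : r ∈ level s ν x₀ (n + 2) := level_mono (by omega) hn
  clear hn
  induction n with
  | zero => exact hn'
  | succ n ih =>
    refine ih ?_
    by_contra hcon
    have hex := exists_sq_eq_of_mem_level hdeg (n := n + 1) hn' hcon (level_mono (by omega) hr2)
    by_cases hne : ν = 2 ∧ x₀ = 1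
    · obtain ⟨rfl, rfl⟩ := hne
      exact no_sq_eq_two_sub_seq hdeg n (by simpa using hex)
    · exact no_sq_eq_sub_seq hν hx₀ hdeg (start_le hν hx₀ hdeg hreal) hne n le_rfl hex

/-- `K_2` is generated over `K_1` by any square root outside `K_1`, so two of them differ by a
factor in `K_1`. -/
theorem mul_mem_level_one (h : (ν, x₀) ∈ Omega s) {r r' : ℂ} (hr : r ∈ field s ν x₀)
    (hr' : r' ∈ field s ν x₀) (hr2 : r ^ 2 ∈ level s ν x₀ 1) (hr2' : r' ^ 2 ∈ level s ν x₀ 1)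
    (hn : r ∉ level s ν x₀ 1) (hn' : r' ∉ level s ν x₀ 1) : r * r' ∈ level s ν x₀ 1 := by
  have hdeg := h.2.2.1
  dsimp only at hdeg
  have key : ∀ t ∈ field s ν x₀, t ^ 2 ∈ level s ν x₀ 1 → t ∉ level s ν x₀ 1 →
      ∃ v ∈ level s ν x₀ 1, t = v * seq s ν x₀ 2 := by
    intro t ht ht2 htn
    obtain ⟨u, hu, v, hv, rfl⟩ := exists_eq_add_mul_of_mem_level_succ
      (mem_level_two_of_sq_mem h ht ht2)
    have hsq := seq_succ_sq s ν x₀ 1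
    have hν : (ν : ℂ) + seq s ν x₀ 1 ∈ level s ν x₀ 1 :=
      add_mem (intCast_mem _ ν) (seq_mem_level 1)
    obtain ⟨-, h2⟩ := eq_zero_of_add_mul_eq_zero
      (u := u ^ 2 + v ^ 2 * (ν + seq s ν x₀ 1) - (u + v * seq s ν x₀ (1 + 1)) ^ 2)
      (v := 2 * u * v) (seq_succ_not_mem_level hdeg 1)
      (sub_mem (add_mem (pow_mem hu 2) (mul_mem (pow_mem hv 2) hν)) ht2)
      (mul_mem (mul_mem (ofNat_mem _ 2) hu) hv)
      (by linear_combination -v ^ 2 * hsq)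
    have hv0 : v ≠ 0 := by
      rintro rfl
      exact htn (by simpa using hu)
    have hu0 : u = 0 := by simpa [hv0] using h2
    exact ⟨v, hv, by simp [hu0]⟩
  obtain ⟨v, hv, rfl⟩ := key r hr hr2 hn
  obtain ⟨v', hv', rfl⟩ := key r' hr' hr2' hn'
  have e : v * seq s ν x₀ 2 * (v' * seq s ν x₀ 2) = v * v' * (ν + seq s ν x₀ 1) := by
    rw [← seq_succ_sq s ν x₀ 1]
    ring
  rw [e]
  exact mul_mem (mul_mem hv hv') (add_mem (intCast_mem _ ν) (seq_mem_level 1))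

/-! ### Maximal subgroups and Kummer generators -/

/-- An element outside the only maximal subgroup lies in no maximal subgroup, so it generates. -/
theorem isCyclic_of_isCoatom_unique {G : Type*} [Group G] [Finite G]
    (h : ∀ M M' : Subgroup G, IsCoatom M → IsCoatom M' → M = M') : IsCyclic G := by
  rw [isCyclic_iff_exists_zpowers_eq_top]
  by_contra! hcon
  obtain ⟨M, hM, -⟩ := (eq_top_or_exists_le_coatom (Subgroup.zpowers (1 : G))).resolve_left (hcon 1)
  obtain ⟨g, -, hg⟩ := SetLike.exists_of_lt hM.lt_top
  obtain ⟨M', hM', hle⟩ := (eq_top_or_exists_le_coatom (Subgroup.zpowers g)).resolve_left (hcon g)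
  rw [h M M' hM hM'] at hg
  exact hg (hle (Subgroup.mem_zpowers g))

/-- Otherwise `M` and `σ ^ 2` generate the group, so an odd power of `σ` lies in `M`; as `σ` has
`2`-power order, so does `σ`. -/
theorem sq_mem_of_isCoatom {G : Type*} [CommGroup G] {k : ℕ} (hG : Nat.card G = 2 ^ k)
    {M : Subgroup G} (hM : IsCoatom M) (σ : G) : σ ^ 2 ∈ M := by
  by_contra hσ
  have hlt : M < M ⊔ Subgroup.zpowers (σ ^ 2) :=
    left_lt_sup.mpr fun hle => hσ (hle (Subgroup.mem_zpowers _))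
  have hmem : σ ∈ M ⊔ Subgroup.zpowers (σ ^ 2) := by
    rw [hM.2 _ hlt]
    trivial
  obtain ⟨m, hm, t, ht, hmt⟩ := Subgroup.mem_sup.mp hmem
  obtain ⟨j, rfl⟩ := Subgroup.mem_zpowers_iff.mp ht
  have hodd : σ ^ (1 - 2 * j : ℤ) ∈ M := by
    have : σ ^ (1 - 2 * j : ℤ) = m := by
      rw [zpow_sub, zpow_one, zpow_mul, mul_inv_eq_iff_eq_mul]
      exact_mod_cast hmt.symm
    rwa [this]
  have hpow : σ ^ ((2 : ℤ) ^ k) = 1 := by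
    have := pow_card_eq_one' (x := σ)
    rw [hG] at this
    exact_mod_cast this
  have hcop : IsCoprime (1 - 2 * j : ℤ) ((2 : ℤ) ^ k) :=
    IsCoprime.pow_right ⟨1, j, by ring⟩
  obtain ⟨a, b, hab⟩ := hcop
  apply hσ
  refine pow_mem ?_ 2
  have : σ = (σ ^ (1 - 2 * j : ℤ)) ^ a := by
    calc σ = σ ^ (a * (1 - 2 * j) + b * 2 ^ k : ℤ) := by rw [hab, zpow_one]
      _ = _ := by rw [zpow_add, mul_comm a, zpow_mul, mul_comm b, zpow_mul, hpow, one_zpow, mul_one]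
  rw [this]
  exact zpow_mem hodd a

/-- A maximal subgroup of an abelian Galois group of order a power of `2` is cut out by a square
root of an element of the base field. -/
theorem exists_sqrt_of_isCoatom {F L : Type*} [Field F] [Field L] [Algebra F L]
    [FiniteDimensional F L] [IsAbelianGalois F L] {k : ℕ} (hk : Module.finrank F L = 2 ^ k)
    {M : Subgroup Gal(L/F)} (hM : IsCoatom M) {σ : Gal(L/F)} (hσ : σ ∉ M) :
    ∃ r : L, r ≠ 0 ∧ σ r = -r ∧ (∀ τ ∈ M, τ r = r) ∧ ∃ a : F, algebraMap F L a = r ^ 2 := by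
  have hcard : Nat.card Gal(L/F) = 2 ^ k := by rw [IsGalois.card_aut_eq_finrank, hk]
  have hcomm : ∀ a b : Gal(L/F), a * b = b * a := fun a b =>
    IsMulCommutative.is_comm.comm a b
  let _ : CommGroup Gal(L/F) := { (inferInstance : Group Gal(L/F)) with mul_comm := hcomm }
  have hσ2 : σ ^ 2 ∈ M := sq_mem_of_isCoatom hcard hM σ
  have hfix : ∃ x ∈ fixedField M, σ x ≠ x := by
    by_contra! hcon
    apply hσ
    rw [← fixingSubgroup_fixedField M]
    exact (IntermediateField.mem_fixingSubgroup_iff _ σ).mpr hcon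
  obtain ⟨x, hx, hσx⟩ := hfix
  rw [mem_fixedField_iff] at hx
  have hσσ : σ (σ x) = x := by
    have := hx _ hσ2
    rwa [pow_two] at this
  have hτ : ∀ τ ∈ M, τ (x - σ x) = x - σ x := by
    intro τ hτ
    have h1 : τ (σ x) = σ (τ x) := congrArg (fun f : Gal(L/F) => f x) (hcomm τ σ)
    rw [map_sub, h1, hx τ hτ]
  have hneg : σ (x - σ x) = -(x - σ x) := by rw [map_sub, hσσ, neg_sub]
  -- `x - σ x` is the `-1` component of `x` under `σ`; its square is fixed by `M` and `σ`, which
  -- generate the group.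
  refine ⟨x - σ x, sub_ne_zero.mpr (Ne.symm hσx), hneg, hτ, ?_⟩
  have hle : M ⊔ Subgroup.zpowers σ ≤ MulAction.stabilizer Gal(L/F) ((x - σ x) ^ 2) := by
    refine sup_le ?_ ?_
    · intro τ h
      rw [MulAction.mem_stabilizer_iff, AlgEquiv.smul_def, map_pow, hτ τ h]
    · rw [Subgroup.zpowers_le, MulAction.mem_stabilizer_iff, AlgEquiv.smul_def, map_pow, hneg,
        neg_sq]
  have hlt : M < M ⊔ Subgroup.zpowers σ :=
    left_lt_sup.mpr fun hle => hσ (hle (Subgroup.mem_zpowers _))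
  rw [hM.2 _ hlt] at hle
  have := (IsGalois.mem_range_algebraMap_iff_fixed ((x - σ x) ^ 2) (F := F)).mpr
    fun τ => hle (Subgroup.mem_top τ)
  exact this

/-! ### Abelian extensions inside the tower -/

theorem finrank_le_finrank_mul_finrank_comap {k L E : Type*} [Field k] [Field L] [Field E]
    [Algebra k L] [Algebra k E] (ι : L →ₐ[k] E) (S : IntermediateField k E)
    [FiniteDimensional k S] :
    Module.finrank k L ≤ Module.finrank k S * Module.finrank (S.comap ι) L := by
  have hle : (S.comap ι).map ι ≤ S := map_le_iff_le_comap.mpr le_rfl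
  rw [← Module.finrank_mul_finrank k (S.comap ι) L,
    ((S.comap ι).equivMap ι).toLinearEquiv.finrank_eq]
  exact Nat.mul_le_mul_right _ (finrank_le_of_le_right hle)

theorem finrank_top_dvd {k L : Type*} [Field k] [Field L] [Algebra k L]
    (F : IntermediateField k L) : Module.finrank F L ∣ Module.finrank k L :=
  ⟨Module.finrank k F, by rw [mul_comm, Module.finrank_mul_finrank]⟩

theorem exists_orderOf_eq_of_intermediateField {k L : Type*} [Field k] [Field L] [Algebra k L]
    {F : IntermediateField k L} (g : Gal(L/F)) : ∃ g' : Gal(L/k), orderOf g' = orderOf g :=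
  ⟨AlgEquiv.restrictScalarsHom k g,
    orderOf_injective _ (AlgEquiv.restrictScalarsHom_injective k) g⟩

/-- A finite extension of `ℚ` inside the tower has degree `2 ^ k`. -/
theorem exists_finrank_eq_two_pow (h : (ν, x₀) ∈ Omega s) {L : Type*} [Field L] [Algebra ℚ L]
    [FiniteDimensional ℚ L] (ι : L →ₐ[ℚ] ℂ) (hι : ∀ x, ι x ∈ field s ν x₀) :
    ∃ k, Module.finrank ℚ L = 2 ^ k := by
  obtain ⟨α, hα⟩ := Field.exists_primitive_element ℚ L
  obtain ⟨n, hn⟩ := mem_field_iff.mp (hι α)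
  have hle : ι.fieldRange ≤ level s ν x₀ n := by
    rw [AlgHom.fieldRange_eq_map, ← hα, adjoin_map, Set.image_singleton, adjoin_simple_le_iff]
    exact hn
  have hfin : Module.finrank ℚ L = Module.finrank ℚ ι.fieldRange :=
    (AlgEquiv.ofInjectiveField ι).toLinearEquiv.finrank_eq
  have hdvd : Module.finrank ℚ ι.fieldRange ∣ 2 ^ n := by
    rw [← finrank_level h.2.2.1 n]
    exact finrank_dvd_of_le_right hle
  obtain ⟨k, -, hk⟩ := (Nat.dvd_prime_pow Nat.prime_two).mp hdvd
  exact ⟨k, hfin.trans hk⟩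

/-- The Galois group of an abelian extension of `ℚ` inside the tower has a cyclic subgroup of index
at most `2`. -/
theorem exists_finrank_le_two_mul_orderOf (h : (ν, x₀) ∈ Omega s) {L : Type*} [Field L]
    [Algebra ℚ L] [FiniteDimensional ℚ L] [IsAbelianGalois ℚ L] (ι : L →ₐ[ℚ] ℂ)
    (hι : ∀ x, ι x ∈ field s ν x₀) :
    ∃ g : Gal(L/ℚ), Module.finrank ℚ L ≤ 2 * orderOf g := by
  set F : IntermediateField ℚ L := (level s ν x₀ 1).comap ι
  have hF2 : Module.finrank ℚ L ≤ 2 * Module.finrank F L := by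
    have : FiniteDimensional ℚ (level s ν x₀ 1) := adjoin.finiteDimensional (isIntegral_seq 1)
    have h1 := finrank_le_finrank_mul_finrank_comap ι (level s ν x₀ 1)
    rwa [finrank_level h.2.2.1 1, pow_one] at h1
  obtain ⟨k, hk⟩ := exists_finrank_eq_two_pow h ι hι
  obtain ⟨j, -, hj⟩ := (Nat.dvd_prime_pow Nat.prime_two).mp
    (hk ▸ finrank_top_dvd F)
  have hcyc : IsCyclic Gal(L/F) := by
    refine isCyclic_of_isCoatom_unique fun M M' hM hM' => ?_
    by_contra hne
    have hnle : ¬ M ≤ M' := fun hle => hne ((hM.le_iff.mp hle).resolve_left hM'.1).symm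
    obtain ⟨τ, hτ, hτ'⟩ := SetLike.not_le_iff_exists.mp hnle
    obtain ⟨σ, -, hσ⟩ := SetLike.exists_of_lt hM.lt_top
    obtain ⟨r, hr0, hrσ, hrM, a, ha⟩ := exists_sqrt_of_isCoatom hj hM hσ
    obtain ⟨r', hr0', hrτ, -, a', ha'⟩ := exists_sqrt_of_isCoatom hj hM' hτ'
    have hnot : ∀ (σ : Gal(L/F)) (t : L), t ≠ 0 → σ t = -t → ι t ∉ level s ν x₀ 1 := by
      intro σ t ht hσt hmem
      have h1 : σ t = t := σ.commutes ⟨t, hmem⟩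
      have : CharZero L := charZero_of_injective_algebraMap (algebraMap ℚ L).injective
      rw [h1] at hσt
      exact ht (self_eq_neg.mp hσt)
    have hsq : ∀ (t : L) (a : F), algebraMap F L a = t ^ 2 → ι t ^ 2 ∈ level s ν x₀ 1 := by
      intro t a hat
      rw [← map_pow, ← hat]
      exact a.2
    have hprod := mul_mem_level_one h (hι r) (hι r') (hsq r a ha) (hsq r' a' ha')
      (hnot σ r hr0 hrσ) (hnot τ r' hr0' hrτ)
    rw [← map_mul] at hprod
    -- `τ` fixes `r` and negates `r'`, so it negates `r * r'`, although this product lies in `K_1`.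
    refine hnot τ (r * r') (mul_ne_zero hr0 hr0') ?_ hprod
    rw [map_mul, hrM τ hτ, hrτ, mul_neg]
  obtain ⟨g, hg⟩ := isCyclic_iff_exists_orderOf_eq_natCard.mp hcyc
  obtain ⟨g', hg'⟩ := exists_orderOf_eq_of_intermediateField g
  refine ⟨g', ?_⟩
  rwa [hg', hg, IsGalois.card_aut_eq_finrank]

/-! ### The real cyclotomic subfield -/

/-- `z` is a root of `X ^ 2 - (z + z⁻¹) * X + 1`. -/
theorem exists_dvd_two_finrank_eq {k C : Type*} [Field k] [Field C] [Algebra k C]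
    [FiniteDimensional k C] {z : C} (hz : k⟮z⟯ = ⊤) (hz0 : z ≠ 0) :
    ∃ d, d ∣ 2 ∧ Module.finrank k C = d * Module.finrank k k⟮z + z⁻¹⟯ := by
  set L := k⟮z + z⁻¹⟯ with hL
  have htop : L⟮z⟯ = ⊤ := by
    rw [← restrictScalars_eq_top_iff (K := k), ← top_le_iff, ← hz, adjoin_simple_le_iff]
    exact mem_adjoin_simple_self L z
  have hint : IsIntegral L z := Algebra.IsIntegral.isIntegral z
  have hdeg : Module.finrank L C = (minpoly L z).natDegree := by
    rw [← adjoin.finrank hint, htop, finrank_top']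
  set c : L := ⟨z + z⁻¹, mem_adjoin_simple_self k _⟩ with hc
  have hle : (minpoly L z).natDegree ≤ 2 := by
    have hmonic : (Polynomial.X ^ 2 - Polynomial.C c * Polynomial.X + 1).Monic := by
      monicity!
    have hroot : Polynomial.aeval z (Polynomial.X ^ 2 - Polynomial.C c * Polynomial.X + 1) = 0 := by
      have hcz : algebraMap L C c = z + z⁻¹ := rfl
      simp only [map_add, map_sub, map_mul, map_pow, Polynomial.aeval_X, Polynomial.aeval_C, hcz,
        map_one]
      field_simp
      ring
    refine (Polynomial.natDegree_le_natDegree (minpoly.min L z hmonic hroot)).trans ?_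
    compute_degree
  refine ⟨(minpoly L z).natDegree, ?_, ?_⟩
  · have := minpoly.natDegree_pos hint
    interval_cases (minpoly L z).natDegree <;> norm_num
  · rw [← hdeg, mul_comm, Module.finrank_mul_finrank]

theorem exists_orderOf_dvd_of_normal {k C : Type*} [Field k] [Field C] [Algebra k C]
    [Normal k C] (L : IntermediateField k C) [Normal k L] (g : Gal(L/k)) :
    ∃ u : Gal(C/k), orderOf g ∣ orderOf u := by
  obtain ⟨u, rfl⟩ := AlgEquiv.restrictNormalHom_surjective (F := k) (K₁ := L) C g
  exact ⟨u, orderOf_map_dvd _ u⟩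

theorem exists_algHom_restrict {k C E : Type*} [Field k] [Field C] [Field E] [Algebra k C]
    [Algebra k E] (ι : C →ₐ[k] E) (L : IntermediateField k C) :
    ∃ f : L →ₐ[k] E, ∀ x, f x = ι x :=
  ⟨ι.comp L.val, fun _ => rfl⟩

/-- If the real subfield of the `m`-th cyclotomic field lies in the tower, then `φ m` is a power of
`2` and some unit modulo `m` has order at least `φ m / 4`. -/
theorem totient_of_mem_field (h : (ν, x₀) ∈ Omega s) {m : ℕ} [NeZero m] {C : Type*} [Field C]
    [Algebra ℚ C] [IsCyclotomicExtension {m} ℚ C] (ι : C →ₐ[ℚ] ℂ) {z : C}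
    (hz : IsPrimitiveRoot z m) (hmem : ι (z + z⁻¹) ∈ field s ν x₀) :
    (∃ k, m.totient ∣ 2 ^ k) ∧ ∃ u : (ZMod m)ˣ, m.totient ≤ 4 * orderOf u := by
  have hfd : FiniteDimensional ℚ C := IsCyclotomicExtension.finiteDimensional {m} ℚ C
  have hab : IsAbelianGalois ℚ C := IsCyclotomicExtension.isAbelianGalois {m} ℚ C
  have hgen : ℚ⟮z⟯ = ⊤ := by
    rw [← toSubalgebra_inj, adjoin_simple_toSubalgebra_of_isAlgebraic
      (Algebra.IsAlgebraic.isAlgebraic z), top_toSubalgebra]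
    exact IsCyclotomicExtension.adjoin_primitive_root_eq_top hz
  obtain ⟨d, hd2, hd⟩ := exists_dvd_two_finrank_eq hgen (hz.ne_zero (NeZero.ne m))
  rw [IsCyclotomicExtension.finrank C
    (Polynomial.cyclotomic.irreducible_rat (NeZero.pos m))] at hd
  let _ : Algebra ℚ ℚ⟮z + z⁻¹⟯ := IntermediateField.algebra' _
  obtain ⟨f, hf⟩ := exists_algHom_restrict ι ℚ⟮z + z⁻¹⟯
  have hι : ∀ x, f x ∈ field s ν x₀ := by
    intro x
    rw [hf]
    have hle : ℚ⟮z + z⁻¹⟯ ≤ (field s ν x₀).comap ι := by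
      rw [adjoin_simple_le_iff]
      exact hmem
    exact hle x.2
  constructor
  · obtain ⟨k, hk⟩ := exists_finrank_eq_two_pow h _ hι
    refine ⟨k + 1, ?_⟩
    rw [hd, hk, pow_succ']
    exact mul_dvd_mul_right hd2 _
  · obtain ⟨g, hg⟩ := exists_finrank_le_two_mul_orderOf h _ hι
    obtain ⟨σ, hσ⟩ := exists_orderOf_dvd_of_normal _ g
    refine ⟨hz.autToPow ℚ σ, ?_⟩
    rw [orderOf_injective _ (hz.autToPow_injective (K := ℚ)), hd]
    have h1 := Nat.le_of_dvd two_pos hd2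
    have h2 := Nat.le_of_dvd (orderOf_pos σ) hσ
    calc _ ≤ 2 * (2 * orderOf g) := Nat.mul_le_mul h1 hg
      _ ≤ _ := by omega

/-! ### Arithmetic of the totient -/

theorem isFermatPrime_of_totient_dvd {p k : ℕ} (hp : p.Prime) (hp2 : p ≠ 2)
    (h : p.totient ∣ 2 ^ k) : IsFermatPrime p := by
  rw [Nat.totient_prime hp] at h
  obtain ⟨j, -, hj⟩ := (Nat.dvd_prime_pow Nat.prime_two).mp h
  have hpj : p = 2 ^ j + 1 := by have := hp.two_le; omega
  have hj0 : j ≠ 0 := by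
    rintro rfl
    exact hp2 (by simpa using hpj)
  obtain ⟨n, hn⟩ := Nat.pow_of_pow_add_prime one_lt_two hj0 (hpj ▸ hp)
  exact ⟨hp, n, by rw [hpj, hn, Nat.fermatNumber]⟩

theorem not_sq_dvd_of_totient_dvd {p m k : ℕ} (hp : p.Prime) (hp2 : p ≠ 2)
    (h : m.totient ∣ 2 ^ k) : ¬ p ^ 2 ∣ m := by
  intro hdvd
  have h1 := (Nat.totient_dvd_of_dvd hdvd).trans h
  rw [Nat.totient_prime_pow_succ hp 1, pow_one] at h1
  have h2 := hp.dvd_of_dvd_pow ((Dvd.intro _ rfl).trans h1)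
  exact hp2 ((Nat.prime_dvd_prime_iff_eq hp Nat.prime_two).mp h2)

theorem eq_two_pow_or_exists_prime_dvd {m : ℕ} (hm : m ≠ 0) :
    (∃ a, m = 2 ^ a) ∨ ∃ p, p.Prime ∧ p ≠ 2 ∧ p ∣ m := by
  obtain ⟨a, d, hd, rfl⟩ := Nat.exists_eq_two_pow_mul_odd hm
  by_cases h1 : d = 1
  · exact Or.inl ⟨a, by simp [h1]⟩
  · obtain ⟨p, hp, hpd⟩ := Nat.exists_prime_and_dvd h1
    refine Or.inr ⟨p, hp, ?_, hpd.mul_left _⟩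
    rintro rfl
    exact (Nat.not_even_iff_odd.mpr hd) (even_iff_two_dvd.mpr hpd)

theorem eq_of_totient_le_four {t k : ℕ} (ht : t ≠ 0) (hk : t.totient ∣ 2 ^ k)
    (h4 : t.totient ≤ 4) :
    (∃ a, t = 2 ^ a) ∨ ∃ a p, a ≤ 2 ∧ IsFermatPrime p ∧ t = 2 ^ a * p := by
  refine (eq_two_pow_or_exists_prime_dvd ht).imp_right ?_
  rintro ⟨p, hp, hp2, u, rfl⟩
  have hp3 : 3 ≤ p := by have := hp.two_le; omega
  have hu : u ≠ 0 := right_ne_zero_of_mul ht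
  have hcop : p.Coprime u := by
    rw [hp.coprime_iff_not_dvd]
    intro hpu
    exact not_sq_dvd_of_totient_dvd hp hp2 hk (by rw [sq]; exact mul_dvd_mul_left p hpu)
  have hpF : IsFermatPrime p :=
    isFermatPrime_of_totient_dvd hp hp2 ((Nat.totient_dvd_of_dvd (Dvd.intro _ rfl)).trans hk)
  rw [Nat.totient_mul hcop, Nat.totient_prime hp] at h4
  have hp1 : 2 ≤ p - 1 := by omega
  rcases eq_two_pow_or_exists_prime_dvd hu with ⟨b, rfl⟩ | ⟨p', hp', hp2', hpu'⟩
  · refine ⟨b, p, ?_, hpF, mul_comm _ _⟩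
    by_contra! hb
    have h8 : Nat.totient 8 ∣ Nat.totient (2 ^ b) :=
      Nat.totient_dvd_of_dvd (pow_dvd_pow 2 hb : 2 ^ 3 ∣ 2 ^ b)
    have h9 := Nat.le_of_dvd (Nat.totient_pos.mpr (by positivity)) h8
    have h10 : Nat.totient 8 = 4 := by decide
    nlinarith
  · have hne : p ≠ p' := by
      rintro rfl
      exact (hp.coprime_iff_not_dvd.mp hcop) hpu'
    have h5 := Nat.le_of_dvd (Nat.totient_pos.mpr (Nat.pos_of_ne_zero hu))
      (Nat.totient_dvd_of_dvd hpu')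
    rw [Nat.totient_prime hp'] at h5
    have hp3' : 3 ≤ p' := by have := hp'.two_le; omega
    -- Two distinct odd primes cannot both be `3`, so the totient would be at least `2 * 3 > 4`.
    have h6 : 3 ≤ p - 1 ∨ 3 ≤ p' - 1 := by omega
    have h7 : 2 ≤ p' - 1 := by omega
    exfalso
    rcases h6 with h6 | h6 <;> nlinarith

/-- A unit of order a power of `2` modulo `m` keeps its order modulo some prime power exactly
dividing `m`. -/
theorem exists_prime_orderOf_dvd_totient {m j : ℕ} [NeZero m] {u : (ZMod m)ˣ}
    (hu : orderOf u = 2 ^ (j + 1)) :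
    ∃ p, p.Prime ∧ p ∣ m ∧ orderOf u ∣ (p ^ m.factorization p).totient := by
  have hne : ((u ^ 2 ^ j : (ZMod m)ˣ) : ZMod m) - 1 ≠ 0 := by
    intro h0
    rw [sub_eq_zero, Units.val_eq_one] at h0
    have h1 := Nat.le_of_dvd (by positivity) (orderOf_dvd_of_pow_eq_one h0)
    rw [hu, pow_succ] at h1
    have : 0 < 2 ^ j := by positivity
    omega
  set x : ZMod m := ((u ^ 2 ^ j : (ZMod m)ˣ) : ZMod m) - 1 with hx
  have hdvd : ¬ m ∣ x.val := by
    rwa [← ZMod.natCast_eq_zero_iff, ZMod.natCast_zmod_val]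
  rw [Nat.dvd_iff_prime_pow_dvd_dvd] at hdvd
  push Not at hdvd
  obtain ⟨p, i, hp, hi, hix⟩ := hdvd
  have hi0 : i ≠ 0 := by
    rintro rfl
    simp at hix
  have hq : p ^ m.factorization p ∣ m := Nat.ordProj_dvd m p
  refine ⟨p, hp, (dvd_pow_self p hi0).trans hi, ?_⟩
  set q := p ^ m.factorization p with hqdef
  have hiq : p ^ i ∣ q :=
    pow_dvd_pow p ((hp.pow_dvd_iff_le_factorization (NeZero.ne m)).mp hi)
  have hxq : ZMod.castHom hq (ZMod q) x ≠ 0 := by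
    rw [← ZMod.natCast_zmod_val x, map_natCast, Ne, ZMod.natCast_eq_zero_iff]
    exact fun h => hix (hiq.trans h)
  have hw : (ZMod.unitsMap hq u) ^ 2 ^ j ≠ 1 := by
    intro h1
    apply hxq
    rw [hx, map_sub, map_one, sub_eq_zero]
    rw [← map_pow] at h1
    exact congrArg Units.val h1
  have hord : orderOf (ZMod.unitsMap hq u) = 2 ^ (j + 1) := by
    refine orderOf_eq_prime_pow hw ?_
    rw [← map_pow, ← hu, pow_orderOf_eq_one, map_one]
  have : NeZero q := ⟨(pow_pos hp.pos _).ne'⟩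
  rw [hu, ← hord, ← ZMod.card_units_eq_totient]
  exact orderOf_dvd_card

theorem forms_of_totient {m k : ℕ} [NeZero m] (hk : m.totient ∣ 2 ^ k) {u : (ZMod m)ˣ}
    (hu : m.totient ≤ 4 * orderOf u) :
    (∃ r p₁ p₂ : ℕ, r ≤ 2 ∧ IsFermatPrime p₁ ∧ IsFermatPrime p₂ ∧ p₁ ≠ p₂ ∧
      m = 2 ^ r * p₁ * p₂) ∨
    (∃ r p₁ : ℕ, IsFermatPrime p₁ ∧ m = 2 ^ r * p₁) ∨ (∃ r : ℕ, m = 2 ^ r) := by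
  have hm : m ≠ 0 := NeZero.ne m
  have hord : orderOf u ∣ 2 ^ k := by
    refine dvd_trans ?_ hk
    rw [← ZMod.card_units_eq_totient]
    exact orderOf_dvd_card
  obtain ⟨j, -, hj⟩ := (Nat.dvd_prime_pow Nat.prime_two).mp hord
  rcases j with _ | j
  -- A trivial `u` singles out no prime, but then `φ(m) ≤ 4` already.
  · rw [hj] at hu
    rcases eq_of_totient_le_four hm hk (by simpa using hu) with h | ⟨a, p, -, hp, h⟩
    · exact Or.inr (Or.inr h)
    · exact Or.inr (Or.inl ⟨a, p, hp, h⟩)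
  obtain ⟨p, hp, hpm, hpu⟩ := exists_prime_orderOf_dvd_totient hj
  have hmt : p ^ m.factorization p * (m / p ^ m.factorization p) = m :=
    Nat.ordProj_mul_ordCompl_eq_self m p
  have hcop : p.Coprime (m / p ^ m.factorization p) := Nat.coprime_ordCompl hp hm
  have hv : 1 ≤ m.factorization p :=
    (hp.dvd_iff_one_le_factorization hm).mp hpm
  set v := m.factorization p with hvdef
  set t := m / p ^ v with ht
  have htm : t ∣ m := ⟨p ^ v, by rw [mul_comm, hmt]⟩
  have ht0 : t ≠ 0 := ne_zero_of_dvd_ne_zero hm htm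
  have hpos : 0 < (p ^ v).totient := Nat.totient_pos.mpr (pow_pos hp.pos _)
  -- `φ(p ^ v) * φ(t) = φ(m) ≤ 4 * orderOf u ≤ 4 * φ(p ^ v)`.
  have ht4 : t.totient ≤ 4 := by
    have h1 := Nat.totient_mul (hcop.pow_left v)
    rw [hmt] at h1
    have := Nat.le_of_dvd hpos hpu
    nlinarith
  have htk : t.totient ∣ 2 ^ k := (Nat.totient_dvd_of_dvd htm).trans hk
  have hcases := eq_of_totient_le_four ht0 htk ht4
  by_cases hp2 : p = 2
  · rw [hp2] at hmt
    rcases hcases with ⟨a, h⟩ | ⟨a, p₁, -, hp₁, h⟩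
    · exact Or.inr (Or.inr ⟨v + a, by rw [← hmt, h, pow_add]⟩)
    · exact Or.inr (Or.inl ⟨v + a, p₁, hp₁, by rw [← hmt, h, pow_add, mul_assoc]⟩)
  · have hv1 : v = 1 := by
      by_contra hne
      exact not_sq_dvd_of_totient_dvd hp hp2 hk
        ((hp.pow_dvd_iff_le_factorization hm).mpr (by omega))
    have hpF : IsFermatPrime p :=
      isFermatPrime_of_totient_dvd hp hp2 ((Nat.totient_dvd_of_dvd hpm).trans hk)
    rw [hv1, pow_one] at hmt
    rcases hcases with ⟨a, h⟩ | ⟨a, p₁, ha, hp₁, h⟩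
    · exact Or.inr (Or.inl ⟨a, p, hpF, by rw [← hmt, h, mul_comm]⟩)
    · refine Or.inl ⟨a, p₁, p, ha, hp₁, hpF, ?_, by rw [← hmt, h, mul_comm]⟩
      rintro rfl
      exact (hp.coprime_iff_not_dvd.mp hcop) (h ▸ Dvd.intro_left _ rfl)

end SqrtTower

theorem corollary1p4 (s : ℕ → ℤˣ) (ν x₀ : ℤ) (hΩ : (ν, x₀) ∈ SqrtTower.Omega s)
    (m : ℕ) (hm : 1 ≤ m) (ζ : ℂ) (hζ : IsPrimitiveRoot ζ m)
    (hmem : ζ + ζ⁻¹ ∈ SqrtTower.field s ν x₀) :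
    (∃ r p₁ p₂ : ℕ, r ≤ 2 ∧ SqrtTower.IsFermatPrime p₁ ∧ SqrtTower.IsFermatPrime p₂ ∧
      p₁ ≠ p₂ ∧ m = 2 ^ r * p₁ * p₂) ∨
    (∃ r p₁ : ℕ, SqrtTower.IsFermatPrime p₁ ∧ m = 2 ^ r * p₁) ∨
    (∃ r : ℕ, m = 2 ^ r) := by
  have : NeZero m := ⟨by omega⟩
  let _ : Algebra ℚ (CyclotomicField m ℚ) := CyclotomicField.algebra m ℚ
  let ι : CyclotomicField m ℚ →ₐ[ℚ] ℂ := IsAlgClosed.lift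
  have hz := IsCyclotomicExtension.zeta_spec m ℚ (CyclotomicField m ℚ)
  -- `ζ` is a power of the image of the standard root, so it comes from the abstract cyclotomic
  -- field.
  obtain ⟨i, -, hi⟩ := (hz.map_of_injective ι.injective).eq_pow_of_pow_eq_one hζ.pow_eq_one
  rw [← map_pow] at hi
  rw [← hi] at hζ hmem
  obtain ⟨⟨k, hk⟩, u, hu⟩ := SqrtTower.totient_of_mem_field hΩ ι
    (IsPrimitiveRoot.of_map_of_injective hζ ι.injective) (by rwa [map_add, map_inv₀])
  exact SqrtTower.forms_of_totient hk hu
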